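/- All Banach lattices are real. For a Banach lattice $E$ let $E'$ be its norm dual, ordered by $f\le g$ iff $f(x)\le g(x)$ for all $x\in E^+$ (again a Banach lattice), and let $|f|$ denote the modulus in $E'$. A sequence $(x_n)$ in $E$ is disjoint if $|x_n|\wedge|x_m|=0$ for $n\neq m$. It is uaw-null if $|x_n|\wedge u\to 0$ weakly for every $u\in E^+$. A set $A\subseteq E$ is solid if $|y|\le|x|$ and $x\in A$ imply $y\in A$; $\mathrm{sol}(A)=\{y: |y|\le |x| \text{ for some } x\in A\}$, and $A^+=A\cap E^+$. A nonempty norm bounded set $A$ is L-weakly compact if $\|x_n\|\to0$ for every disjoint sequence $(x_n)\subseteq \mathrm{sol}(A)$. A bounded operator $S$ from a Banach lattice to a normed space is uaw-Dunford–Pettis if $\|Sx_n\|\to0$ for every norm bounded uaw-null sequence $(x_n)$. **Theorem.** Let $E,F$ be Banach lattices and let $T:E\to F$ be a bounded linear operator with adjoint $T':F'\to E'$. (A) For every nonempty norm bounded solid subset $A$ of $E$ the following are equivalent: 1. $T(A)$ is L-weakly compact in $F$. 2. For every $x\in A^+$ the set $T([-x,x])$ is L-weakly compact, and for every disjoint sequence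 $(x_n)$ in $A^+$ the set $\{T(x_n): n\in\mathbb N\}$ is L-weakly compact. 3. For every norm bounded uaw-null sequence $(f_n)$ in $F'$: $|T'f_n|(x)\to0$ for every $x\in A^+$, and $f_n(Tx_n)\to0$ for every disjoint sequence $(x_n)$ in $A^+$. (B) Let $B_E$ be the closed unit ball of $E$. The following are equivalent: 1. $T':F'\to E'$ is uaw-Dunford–Pettis. 2. $T(B_E)$ is L-weakly compact in $F$. 3. For every $x\in E^+$ the set $T([-x,x])$ is L-weakly compact, and for every disjoint sequence $(x_n)$ in $B_E^+$ the set $\{T(x_n): n\in\mathbb N\}$ is L-weakly compact. 4. For every norm bounded uaw-null sequence $(f_n)$ in $F'$: $|T'f_n|\to0$ in the weak* topology of $E'$, and $f_n(Tx_n)\to0$ for every disjoint sequence $(x_n)$ in $B_E^+$. -/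

import Mathlib

open Filter Topology

/-! ## The dual Banach lattice

The norm dual of a Banach lattice, ordered by `f ≤ g ↔ ∀ x ≥ 0, f x ≤ g x`, is a Banach lattice.
The modulus is built by the Riesz–Kantorovich formula. -/

namespace DualLattice

section Modulus

variable {E : Type*} [NormedAddCommGroup E] [Lattice E] [HasSolidNorm E] [IsOrderedAddMonoid E]
  [NormedSpace ℝ E]

/-- `sup {f y : |y| ≤ x}`; used for `x ≥ 0`. -/
noncomputable def posModulus (f : StrongDual ℝ E) (x : E) : ℝ := sSup (f '' {y | |y| ≤ x})

theorem le_of_abs_le (f : StrongDual ℝ E) {x y : E} (h : |y| ≤ x) : f y ≤ ‖f‖ * ‖x‖ := by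
  have hx : 0 ≤ x := (abs_nonneg y).trans h
  have h1 : ‖y‖ ≤ ‖x‖ := norm_le_norm_of_abs_le_abs (by rwa [abs_of_nonneg hx])
  calc f y ≤ ‖f y‖ := Real.le_norm_self _
    _ ≤ ‖f‖ * ‖y‖ := f.le_opNorm y
    _ ≤ ‖f‖ * ‖x‖ := by gcongr

theorem bddAbove_image (f : StrongDual ℝ E) (x : E) : BddAbove (f '' {y | |y| ≤ x}) := by
  refine ⟨‖f‖ * ‖x‖, ?_⟩
  rintro _ ⟨y, hy, rfl⟩
  exact le_of_abs_le f hy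

theorem le_posModulus (f : StrongDual ℝ E) {x y : E} (h : |y| ≤ x) : f y ≤ posModulus f x :=
  le_csSup (bddAbove_image f x) ⟨y, h, rfl⟩

theorem posModulus_le (f : StrongDual ℝ E) {x : E} (hx : 0 ≤ x) {c : ℝ}
    (h : ∀ y, |y| ≤ x → f y ≤ c) : posModulus f x ≤ c := by
  refine csSup_le ⟨f 0, 0, by simpa using hx, rfl⟩ ?_
  rintro _ ⟨y, hy, rfl⟩
  exact h y hy

theorem posModulus_nonneg (f : StrongDual ℝ E) {x : E} (hx : 0 ≤ x) : 0 ≤ posModulus f x := by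
  simpa using le_posModulus f (x := x) (y := 0) (by simpa using hx)

theorem posModulus_zero (f : StrongDual ℝ E) : posModulus f 0 = 0 := by
  refine le_antisymm (posModulus_le f le_rfl ?_) (posModulus_nonneg f le_rfl)
  intro y hy
  simpa using le_of_abs_le f hy

/-- Riesz decomposition. -/
theorem exists_decomp {x y c : E} (hx : 0 ≤ x) (hy : 0 ≤ y) (h : |c| ≤ x + y) :
    ∃ a b, c = a + b ∧ |a| ≤ x ∧ |b| ≤ y := by
  refine ⟨(c ⊓ x) ⊔ (-x), c - ((c ⊓ x) ⊔ (-x)), by abel, ?_, ?_⟩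
  · rw [abs_le']
    constructor
    · exact sup_le inf_le_right (neg_le_self hx)
    · rw [neg_le]
      exact le_sup_right
  · rw [abs_le'] at h ⊢
    obtain ⟨h1, h2⟩ := h
    constructor
    · rw [sub_le_comm]
      refine le_trans (le_inf ?_ ?_) le_sup_left
      · exact sub_le_self c hy
      · rwa [sub_le_iff_le_add]
    · rw [neg_sub, sub_le_iff_le_add]
      refine sup_le ?_ ?_
      · exact inf_le_left.trans (le_add_of_nonneg_left hy)
      · rw [neg_le_iff_add_nonneg]
        have : 0 ≤ (x + y) + c := neg_le_iff_add_nonneg.1 (by simpa [neg_le] using h2)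
        calc (0 : E) ≤ (x + y) + c := this
          _ = y + c + x := by abel

theorem posModulus_add (f : StrongDual ℝ E) {x y : E} (hx : 0 ≤ x) (hy : 0 ≤ y) :
    posModulus f (x + y) = posModulus f x + posModulus f y := by
  apply le_antisymm
  · refine posModulus_le f (add_nonneg hx hy) fun c hc => ?_
    obtain ⟨a, b, rfl, ha, hb⟩ := exists_decomp hx hy hc
    rw [map_add]
    exact add_le_add (le_posModulus f ha) (le_posModulus f hb)
  · rw [← le_sub_iff_add_le]
    refine posModulus_le f hx fun a ha => ?_
    rw [le_sub_comm]
    refine posModulus_le f hy fun b hb => ?_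
    rw [le_sub_iff_add_le', ← map_add]
    exact le_posModulus f ((abs_add_le a b).trans (add_le_add ha hb))

/-- The additive extension of `posModulus f` from the positive cone to `E`. -/
noncomputable def modulusHom (f : StrongDual ℝ E) : E →+ ℝ where
  toFun x := posModulus f x⁺ - posModulus f x⁻
  map_zero' := by simp
  map_add' x y := by
    have h : (x + y)⁺ + (x⁻ + y⁻) = (x + y)⁻ + (x⁺ + y⁺) := by
      have e1 := posPart_sub_negPart (x + y)
      have e2 := posPart_sub_negPart x
      have e3 := posPart_sub_negPart y
      rw [← sub_eq_zero]
      calc (x + y)⁺ + (x⁻ + y⁻) - ((x + y)⁻ + (x⁺ + y⁺))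
          = ((x + y)⁺ - (x + y)⁻) - (x⁺ - x⁻) - (y⁺ - y⁻) := by abel
        _ = 0 := by rw [e1, e2, e3]; abel
    have h' := congrArg (posModulus f) h
    have px := posPart_nonneg x
    have nx := negPart_nonneg x
    have py := posPart_nonneg y
    have ny := negPart_nonneg y
    rw [posModulus_add f (posPart_nonneg _) (add_nonneg nx ny), posModulus_add f nx ny,
      posModulus_add f (negPart_nonneg _) (add_nonneg px py), posModulus_add f px py] at h'
    linarith

theorem modulusHom_of_nonneg (f : StrongDual ℝ E) {x : E} (hx : 0 ≤ x) :
    modulusHom f x = posModulus f x := by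
  change posModulus f x⁺ - posModulus f x⁻ = _
  rw [posPart_of_nonneg hx, negPart_of_nonneg hx, posModulus_zero, sub_zero]

theorem norm_modulusHom_le (f : StrongDual ℝ E) (x : E) : ‖modulusHom f x‖ ≤ ‖f‖ * ‖x‖ := by
  have h : posModulus f x⁺ + posModulus f x⁻ = posModulus f |x| := by
    rw [← posModulus_add f (posPart_nonneg x) (negPart_nonneg x), posPart_add_negPart]
  have h2 : posModulus f |x| ≤ ‖f‖ * ‖x‖ := by
    rw [← norm_abs_eq_norm x]
    exact posModulus_le f (abs_nonneg x) fun y hy => le_of_abs_le f hy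
  have h3 := posModulus_nonneg f (posPart_nonneg x)
  have h4 := posModulus_nonneg f (negPart_nonneg x)
  change ‖posModulus f x⁺ - posModulus f x⁻‖ ≤ _
  rw [Real.norm_eq_abs, abs_le']
  constructor <;> linarith

/-- The Riesz–Kantorovich modulus of a functional. -/
noncomputable def modulus (f : StrongDual ℝ E) : StrongDual ℝ E :=
  (modulusHom f).toRealLinearMap
    (AddMonoidHomClass.continuous_of_bound (modulusHom f) ‖f‖ (norm_modulusHom_le f))

theorem modulus_apply (f : StrongDual ℝ E) {x : E} (hx : 0 ≤ x) :
    modulus f x = sSup (f '' {y | |y| ≤ x}) :=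
  modulusHom_of_nonneg f hx

/-- The dual order. -/
noncomputable instance instPartialOrder : PartialOrder (StrongDual ℝ E) where
  le f g := ∀ x : E, 0 ≤ x → f x ≤ g x
  le_refl _ _ _ := le_rfl
  le_trans _ _ _ h1 h2 x hx := (h1 x hx).trans (h2 x hx)
  le_antisymm f g h1 h2 := by
    ext x
    have key : ∀ y : E, 0 ≤ y → f y = g y := fun y hy => le_antisymm (h1 y hy) (h2 y hy)
    rw [← posPart_sub_negPart x, map_sub, map_sub, key _ (posPart_nonneg x),
      key _ (negPart_nonneg x)]

theorem le_def {f g : StrongDual ℝ E} : f ≤ g ↔ ∀ x : E, 0 ≤ x → f x ≤ g x := Iff.rfl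

instance instIsOrderedAddMonoid : IsOrderedAddMonoid (StrongDual ℝ E) where
  add_le_add_left _ _ h c x hx := by simpa using h x hx

instance instIsOrderedModule : IsOrderedModule ℝ (StrongDual ℝ E) where
  smul_le_smul_of_nonneg_left a ha f g h x hx := by
    simpa using mul_le_mul_of_nonneg_left (h x hx) ha
  smul_le_smul_of_nonneg_right f hf a b h x hx := by
    simpa using mul_le_mul_of_nonneg_right h (by simpa using hf x hx)

theorem self_le_modulus (f : StrongDual ℝ E) : f ≤ modulus f := fun x hx => by
  rw [modulus_apply f hx]
  exact le_posModulus f (abs_of_nonneg hx).le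

theorem neg_le_modulus (f : StrongDual ℝ E) : -f ≤ modulus f := fun x hx => by
  rw [modulus_apply f hx]
  have := le_posModulus f (x := x) (y := -x) (by rw [abs_neg, abs_of_nonneg hx])
  simpa [posModulus] using this

theorem modulus_le {f g : StrongDual ℝ E} (h1 : f ≤ g) (h2 : -f ≤ g) : modulus f ≤ g :=
  fun x hx => by
    rw [modulus_apply f hx]
    refine posModulus_le f hx fun y hy => ?_
    have e1 := h1 _ (posPart_nonneg y)
    have e2 := h2 _ (negPart_nonneg y)
    have hg : 0 ≤ g (x - |y|) := by
      have p1 := h1 _ (sub_nonneg.2 hy)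
      have p2 := h2 _ (sub_nonneg.2 hy)
      rw [ContinuousLinearMap.neg_apply] at p2
      linarith
    rw [ContinuousLinearMap.neg_apply] at e2
    rw [map_sub, ← posPart_add_negPart, map_add] at hg
    have e3 : f y = f y⁺ - f y⁻ := by rw [← map_sub, posPart_sub_negPart]
    linarith

/-- The lattice structure: `f ⊔ g = (f + g + |f - g|) / 2` and `f ⊓ g = (f + g - |f - g|) / 2`. -/
noncomputable instance instLattice : Lattice (StrongDual ℝ E) where
  sup f g := (2⁻¹ : ℝ) • (f + g + modulus (f - g))
  inf f g := (2⁻¹ : ℝ) • (f + g - modulus (f - g))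
  le_sup_left f g x hx := by
    have := self_le_modulus (f - g) x hx
    simp at this ⊢; linarith
  le_sup_right f g x hx := by
    have := neg_le_modulus (f - g) x hx
    simp at this ⊢; linarith
  sup_le f g k h1 h2 x hx := by
    have h : modulus (f - g) ≤ k + k - f - g := by
      apply modulus_le <;> intro y hy <;>
      · have p1 := h1 y hy
        have p2 := h2 y hy
        simp
        linarith
    have := h x hx
    simp at this ⊢; linarith
  inf_le_left f g x hx := by
    have := neg_le_modulus (f - g) x hx
    simp at this ⊢; linarith
  inf_le_right f g x hx := by
    have := self_le_modulus (f - g) x hx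
    simp at this ⊢; linarith
  le_inf k f g h1 h2 x hx := by
    have h : modulus (f - g) ≤ f + g - k - k := by
      apply modulus_le <;> intro y hy <;>
      · have p1 := h1 y hy
        have p2 := h2 y hy
        simp
        linarith
    have := h x hx
    simp at this ⊢; linarith

theorem abs_eq_modulus (f : StrongDual ℝ E) : |f| = modulus f :=
  le_antisymm (sup_le (self_le_modulus f) (neg_le_modulus f))
    (modulus_le (le_abs_self f) (neg_le_abs f))

instance instHasSolidNorm : HasSolidNorm (StrongDual ℝ E) where
  solid f g h := by
    rw [abs_eq_modulus, abs_eq_modulus] at h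
    refine f.opNorm_le_bound (norm_nonneg g) fun x => ?_
    have hx := abs_nonneg x
    have h1 := h |x| hx
    rw [modulus_apply f hx, modulus_apply g hx] at h1
    have h2 : posModulus g |x| ≤ ‖g‖ * ‖x‖ := by
      rw [← norm_abs_eq_norm x]
      exact posModulus_le g hx fun y hy => le_of_abs_le g hy
    have h3 := le_posModulus f (x := |x|) (y := x) le_rfl
    have h4 := le_posModulus f (x := |x|) (y := -x) (abs_neg x).le
    rw [map_neg] at h4
    rw [Real.norm_eq_abs, abs_le']
    unfold posModulus at h2 h3 h4
    constructor <;> linarith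

end Modulus

end DualLattice

/-! ## L-weakly compact sets and unbounded absolutely weak convergence -/

section BanachLattice

variable {E : Type*} [NormedAddCommGroup E] [Lattice E]

/-- The terms of the sequence are pairwise disjoint: `|x m| ∧ |x n| = 0` for `m ≠ n`. -/
def DisjointSeq (x : ℕ → E) : Prop := ∀ m n, m ≠ n → |x m| ⊓ |x n| = 0

/-- A nonempty norm bounded set such that every disjoint sequence in its solid hull
`{y | ∃ x ∈ A, |y| ≤ |x|}` converges to zero in norm. -/
def IsLWeaklyCompact (A : Set E) : Prop :=
  A.Nonempty ∧ Bornology.IsBounded A ∧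
    ∀ x : ℕ → E, (∀ n, x n ∈ LatticeOrderedAddCommGroup.solidClosure A) → DisjointSeq x →
      Tendsto (fun n => ‖x n‖) atTop (𝓝 0)

/-- `x n` is uaw-null: `|x n| ∧ u → 0` weakly for each `u ≥ 0`. -/
def UawNull [NormedSpace ℝ E] (x : ℕ → E) : Prop :=
  ∀ u : E, 0 ≤ u → ∀ φ : StrongDual ℝ E, Tendsto (fun n => φ (|x n| ⊓ u)) atTop (𝓝 0)

/-- Norm bounded uaw-null sequences are mapped to norm null sequences. -/
def IsUawDunfordPettis [NormedSpace ℝ E] {Y : Type*} [NormedAddCommGroup Y] [NormedSpace ℝ Y]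
    (T : E →L[ℝ] Y) : Prop :=
  ∀ x : ℕ → E, Bornology.IsBounded (Set.range x) → UawNull x →
    Tendsto (fun n => ‖T (x n)‖) atTop (𝓝 0)

end BanachLattice

/-- The adjoint operator `T' : F' → E'`, `T' f = f ∘ T`. -/
noncomputable def adjointOp {E F : Type*} [NormedAddCommGroup E] [NormedSpace ℝ E]
    [NormedAddCommGroup F] [NormedSpace ℝ F] (T : E →L[ℝ] F) :
    StrongDual ℝ F →L[ℝ] StrongDual ℝ E :=
  ContinuousLinearMap.precomp ℝ T

/-! The theorem rests on a duality: in a Banach lattice, a nonempty bounded set `B` is L-weakly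
compact iff every bounded uaw-null sequence of functionals tends to zero uniformly on `B`.

Necessity is `IsLWeaklyCompact.tendsto_abs_apply_abs`. If the `|f n|` are pointwise null on the
positive part of the solid hull of `B` but not uniformly so, disjointification
(`exists_disjoint_subseq`) gives a disjoint sequence in the hull on which they stay large, although
its norms tend to zero. Pointwise nullity (`tendsto_abs_apply_of_uawNull`) holds because norm null
disjoint sequences in `[0, u]` force monotone sequences in `[0, u]` to converge in norm.

Sufficiency is `isLWeaklyCompact_of_uawNull`. Given disjoint `y n` with `|y n| ≤ |z n|` and `z n ∈
B`, a functional norming `|y n|` is cut down to the band of `y n`. Hahn–Banach then gives disjoint,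
hence uaw-null, functionals `f n` with `‖y n‖ ≤ f n (z n)`.

Part (A) combines the duality with disjointification in `E` for the functionals `|T' f n|`. Part (B)
is the case of the unit ball, plus estimates by `‖T' f n‖`. -/

theorem exists_frequently_lt_of_not_tendsto_zero {c : ℕ → ℝ} (hc : ∀ n, 0 ≤ c n)
    (h : ¬Tendsto c atTop (𝓝 0)) : ∃ ε > 0, ∃ᶠ n in atTop, ε < c n := by
  by_contra! H
  refine h (tendsto_order.2 ⟨fun a ha => Eventually.of_forall fun n => ha.trans_le (hc n),
    fun a ha => ?_⟩)
  filter_upwards [H (a / 2) (half_pos ha)] with n hn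
  linarith

/-! ### Disjointness in vector lattices -/

section RieszSpace

variable {G : Type*} [AddCommGroup G] [Lattice G] [IsOrderedAddMonoid G]

theorem add_inf_le_inf_add_inf {a b c : G} (ha : 0 ≤ a) (hb : 0 ≤ b) (hc : 0 ≤ c) :
    (a + b) ⊓ c ≤ a ⊓ c + b ⊓ c := by
  rw [inf_add, add_inf, add_inf]
  exact le_inf (le_inf inf_le_left (inf_le_right.trans (le_add_of_nonneg_left ha)))
    (le_inf (inf_le_right.trans (le_add_of_nonneg_right hb))
      (inf_le_right.trans (le_add_of_nonneg_right hc)))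

theorem mem_Icc_neg_iff_abs_le {x y : G} : y ∈ Set.Icc (-x) x ↔ |y| ≤ x := by
  rw [Set.mem_Icc, abs_le', neg_le, and_comm]

/-- A finite sum of pairwise disjoint elements of `[0, u]` lies below `u`. -/
theorem sum_le_of_pairwise_inf_eq_zero {w : ℕ → G} {u : G} (hu : 0 ≤ u) (h0 : ∀ n, 0 ≤ w n)
    (hle : ∀ n, w n ≤ u) (hd : ∀ m n, m ≠ n → w m ⊓ w n = 0) (N : ℕ) :
    ∑ i ∈ Finset.range N, w i ≤ u := by
  have hsum (N : ℕ) : 0 ≤ ∑ i ∈ Finset.range N, w i := Finset.sum_nonneg fun i _ => h0 i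
  have hdisj : ∀ N m, N ≤ m → (∑ i ∈ Finset.range N, w i) ⊓ w m = 0 := by
    intro N m
    induction N with
    | zero => intro _; simpa using h0 m
    | succ N ih =>
      intro h
      rw [Finset.sum_range_succ]
      refine le_antisymm ?_ (le_inf (add_nonneg (hsum N) (h0 N)) (h0 m))
      refine (add_inf_le_inf_add_inf (hsum N) (h0 N) (h0 m)).trans ?_
      rw [ih (by omega), hd N m (by omega), add_zero]
  induction N with
  | zero => simpa using hu
  | succ N ih =>
    rw [Finset.sum_range_succ]
    -- For disjoint elements the sum equals the supremum.
    have h := inf_add_sup (∑ i ∈ Finset.range N, w i) (w N)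
    rw [hdisj N N le_rfl, zero_add] at h
    rw [← h]
    exact sup_le ih (hle N)

variable [Module ℝ G] [IsOrderedModule ℝ G]

omit [IsOrderedAddMonoid G] in
theorem smul_inf_of_pos {c : ℝ} (hc : 0 < c) (a b : G) : c • (a ⊓ b) = c • a ⊓ c • b :=
  (OrderIso.smulRight hc : G ≃o G).map_inf a b

/-- Up to the factor `max 1 c`, the two elements lie below the disjoint elements `v⁺` and `v⁻`. -/
theorem inf_eq_zero_of_le_posPart {c : ℝ} {x y v : G} (hx0 : 0 ≤ x) (hy0 : 0 ≤ y) (hc : 0 < c)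
    (hx : x ≤ v⁺) (hy : y ≤ (-(c • v))⁺) : x ⊓ y = 0 := by
  refine le_antisymm ?_ (le_inf hx0 hy0)
  have h1 : x ≤ max 1 c • v⁺ := hx.trans <| by
    simpa using smul_le_smul_of_nonneg_right (le_max_left 1 c) (posPart_nonneg v)
  have h2 : y ≤ max 1 c • v⁻ := by
    have hn : 0 ≤ v⁻ := negPart_nonneg v
    refine hy.trans (sup_le ?_ (smul_nonneg (by positivity) hn))
    rw [← smul_neg]
    exact (smul_le_smul_of_nonneg_left (neg_le_negPart v) hc.le).trans
      (smul_le_smul_of_nonneg_right (le_max_right 1 c) hn)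
  calc x ⊓ y ≤ max 1 c • v⁺ ⊓ max 1 c • v⁻ := inf_le_inf h1 h2
    _ = 0 := by rw [← smul_inf_of_pos (by positivity), posPart_inf_negPart_eq_zero, smul_zero]

end RieszSpace

/-! ### Positive functionals and disjointification -/

section NormedLattice

variable {E : Type*} [NormedAddCommGroup E] [Lattice E] [HasSolidNorm E] [IsOrderedAddMonoid E]
  [NormedSpace ℝ E]

omit [HasSolidNorm E] in
theorem StrongDual.mono_of_nonneg {g : StrongDual ℝ E} (hg : 0 ≤ g) {x y : E} (h : x ≤ y) :
    g x ≤ g y := by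
  have := hg (y - x) (sub_nonneg.2 h)
  simpa using this

omit [HasSolidNorm E] in
theorem StrongDual.nonneg_apply {g : StrongDual ℝ E} (hg : 0 ≤ g) {x : E} (h : 0 ≤ x) :
    0 ≤ g x := by
  simpa using hg x h

omit [Lattice E] [HasSolidNorm E] [IsOrderedAddMonoid E] in
theorem StrongDual.apply_le {g : StrongDual ℝ E} {M : ℝ} (hM : ‖g‖ ≤ M) (x : E) :
    g x ≤ M * ‖x‖ :=
  (Real.le_norm_self _).trans (g.le_of_opNorm_le hM x)

theorem exists_nonneg_norming (x : E) (hx : 0 ≤ x) :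
    ∃ g : StrongDual ℝ E, 0 ≤ g ∧ ‖g‖ ≤ 1 ∧ ‖x‖ ≤ g x := by
  obtain ⟨f, hf, hfx⟩ := exists_dual_vector'' ℝ x
  refine ⟨|f|, abs_nonneg f, by rwa [norm_abs_eq_norm], ?_⟩
  have := le_abs_self f x hx
  rw [hfx] at this
  simpa using this

theorem abs_apply_le_abs_apply_abs (f : StrongDual ℝ E) (x : E) : |f x| ≤ |f| |x| := by
  have hx := abs_nonneg x
  rw [DualLattice.abs_eq_modulus, DualLattice.modulus_apply f hx]
  have h1 := DualLattice.le_posModulus f (x := |x|) (y := x) le_rfl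
  have h2 := DualLattice.le_posModulus f (x := |x|) (y := -x) (abs_neg x).le
  rw [map_neg] at h2
  exact abs_le'.2 ⟨h1, h2⟩

theorem exists_lt_of_lt_abs_apply {f : StrongDual ℝ E} {x : E} (hx : 0 ≤ x) {c : ℝ}
    (h : c < |f| x) : ∃ y, |y| ≤ x ∧ c < f y := by
  by_contra! H
  rw [DualLattice.abs_eq_modulus, DualLattice.modulus_apply f hx] at h
  exact h.not_ge (DualLattice.posModulus_le f hx H)

variable [IsOrderedModule ℝ E]

/-- Disjointification: the positive parts of `z k - c k • s k - r` are pairwise disjoint, and the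
functionals `g k` remain large on them. -/
theorem exists_disjointSeq_of_le_smul {z s : ℕ → E} {r : E} {c : ℕ → ℝ} {g : ℕ → StrongDual ℝ E}
    {ε : ℝ} (hz0 : ∀ k, 0 ≤ z k) (hs0 : ∀ k, 0 ≤ s k) (hr : 0 ≤ r) (hc : ∀ k, 0 < c k)
    (hz : ∀ k, z k ≤ c k • r) (hs : ∀ j k, j < k → z j ≤ s k) (hg : ∀ k, 0 ≤ g k)
    (hgz : ∀ k, ε < g k (z k)) (hgs : ∀ k, c k * g k (s k) ≤ ε / 4) (hgr : ∀ k, g k r ≤ ε / 4) :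
    ∃ x : ℕ → E, DisjointSeq x ∧ ∀ k, 0 ≤ x k ∧ x k ≤ z k ∧ ε / 2 < g k (x k) := by
  have hcs (k : ℕ) : 0 ≤ c k • s k := smul_nonneg (hc k).le (hs0 k)
  have key : ∀ j k, j < k →
      |(z j - c j • s j - r)⁺| ⊓ |(z k - c k • s k - r)⁺| = 0 := by
    intro j k hjk
    rw [abs_of_nonneg (posPart_nonneg _), abs_of_nonneg (posPart_nonneg _)]
    -- With `v = z j - (c k)⁻¹ • z k`, the `j`-th difference is at most `v` because `z k ≤ c k • r`,
    -- and the `k`-th is at most `-(c k • v)` because `z j ≤ s k`.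
    refine inf_eq_zero_of_le_posPart (posPart_nonneg _) (posPart_nonneg _) (hc k)
      (v := z j - (c k)⁻¹ • z k) (posPart_mono ?_) (posPart_mono ?_)
    · have h : (c k)⁻¹ • z k ≤ r := by
        have := smul_le_smul_of_nonneg_left (hz k) (inv_nonneg.2 (hc k).le)
        rwa [smul_smul, inv_mul_cancel₀ (hc k).ne', one_smul] at this
      calc z j - c j • s j - r ≤ z j - 0 - (c k)⁻¹ • z k :=
            sub_le_sub (sub_le_sub_left (hcs j) _) h
        _ = _ := by rw [sub_zero]
    · have h := smul_le_smul_of_nonneg_left (hs j k hjk) (hc k).le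
      calc z k - c k • s k - r ≤ z k - c k • z j - 0 :=
            sub_le_sub (sub_le_sub_left h _) hr
        _ = _ := by rw [smul_sub, smul_smul, mul_inv_cancel₀ (hc k).ne', one_smul]; abel
  refine ⟨fun k => (z k - c k • s k - r)⁺, fun m n hmn => ?_, fun k => ⟨posPart_nonneg _, ?_, ?_⟩⟩
  · rcases hmn.lt_or_gt with h | h
    · exact key m n h
    · rw [inf_comm]
      exact key n m h
  · refine sup_le ?_ (hz0 k)
    exact (sub_le_self _ hr).trans (sub_le_self _ (hcs k))
  · have h := StrongDual.mono_of_nonneg (hg k) (le_posPart (z k - c k • s k - r))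
    rw [map_sub, map_sub, map_smul, smul_eq_mul] at h
    linarith [hgz k, hgs k, hgr k]

variable [CompleteSpace E]

/-- Positive functionals that tend to zero pointwise on the positive part of a bounded solid set,
but not uniformly on it, stay large along a disjoint sequence of the set. -/
theorem exists_disjoint_subseq {S : Set E} (hS : LatticeOrderedAddCommGroup.IsSolid S)
    (hSb : Bornology.IsBounded S) {g : ℕ → StrongDual ℝ E} (hg : ∀ n, 0 ≤ g n) {M : ℝ}
    (hM : ∀ n, ‖g n‖ ≤ M) (hpt : ∀ a ∈ S, 0 ≤ a → Tendsto (fun n => g n a) atTop (𝓝 0))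
    {a : ℕ → E} (haS : ∀ n, a n ∈ S) (ha0 : ∀ n, 0 ≤ a n) {ε : ℝ} (hε : 0 < ε)
    (hfreq : ∃ᶠ n in atTop, ε < g n (a n)) :
    ∃ (φ : ℕ → ℕ) (x : ℕ → E), StrictMono φ ∧ DisjointSeq x ∧
      ∀ k, 0 ≤ x k ∧ x k ∈ S ∧ ε / 2 < g (φ k) (x k) := by
  obtain ⟨R, hR⟩ := hSb.exists_norm_le
  have hM0 : 0 ≤ M := (norm_nonneg _).trans (hM 0)
  have hR0 : 0 ≤ R := (norm_nonneg _).trans (hR _ (haS 0))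
  -- The element `r` will be `t` times a series of norm at most `2 * R`; this `t` makes every `g n
  -- r` at most `ε / 4`.
  obtain ⟨t, ht, htε⟩ : ∃ t : ℝ, 0 < t ∧ M * (t * (2 * R)) ≤ ε / 4 := by
    refine ⟨ε / 4 / (M * (2 * R) + 1), by positivity, ?_⟩
    have : M * (ε / 4 / (M * (2 * R) + 1) * (2 * R))
        = ε / 4 * (M * (2 * R) / (M * (2 * R) + 1)) := by ring
    rw [this]
    refine mul_le_of_le_one_right (by positivity) ?_
    exact div_le_one_of_le₀ (by linarith) (by positivity)
  -- Pointwise convergence makes `g n` small on the finitely many terms `a 0, …, a m`. The weight `2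
  -- ^ (m + 1) / t` will dominate `c k = 2 ^ k / t` at `m = p k`, since `k ≤ p k`.
  have hnext (m : ℕ) : ∃ n, m < n ∧ ε < g n (a n) ∧
      2 ^ (m + 1) / t * g n (∑ i ∈ Finset.range (m + 1), a i) ≤ ε / 4 := by
    have hlim : Tendsto (fun n => 2 ^ (m + 1) / t * g n (∑ i ∈ Finset.range (m + 1), a i))
        atTop (𝓝 0) := by
      have : Tendsto (fun n => ∑ i ∈ Finset.range (m + 1), g n (a i)) atTop (𝓝 0) := by
        simpa using tendsto_finsetSum (Finset.range (m + 1))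
          fun i _ => hpt (a i) (haS i) (ha0 i)
      simpa [map_sum] using this.const_mul (2 ^ (m + 1) / t)
    have hev := (hlim.eventually_le_const (by positivity : (0 : ℝ) < ε / 4)).and
      (eventually_gt_atTop m)
    obtain ⟨n, h1, h2, h3⟩ := (hfreq.and_eventually hev).exists
    exact ⟨n, h3, h1, h2⟩
  choose ν hν1 hν2 hν3 using hnext
  let p : ℕ → ℕ := fun k => ν^[k] 0
  have hp (k : ℕ) : p (k + 1) = ν (p k) := Function.iterate_succ_apply' ν k 0
  have hpmono : StrictMono p := strictMono_nat_of_lt_succ fun k => by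
    rw [hp]; exact hν1 _
  let φ : ℕ → ℕ := fun k => p (k + 1)
  have hφ : StrictMono φ := fun i j h => hpmono (by omega)
  have hsum : Summable fun k => ((1 / 2 : ℝ) ^ k) • a (φ k) := by
    refine Summable.of_norm_bounded (g := fun k => (1 / 2 : ℝ) ^ k * R)
      (summable_geometric_two.mul_right R) fun k => ?_
    rw [norm_smul, norm_pow, Real.norm_of_nonneg (by norm_num)]
    exact mul_le_mul_of_nonneg_left (hR _ (haS _)) (by positivity)
  have hterm (k : ℕ) : 0 ≤ ((1 / 2 : ℝ) ^ k) • a (φ k) := smul_nonneg (by positivity) (ha0 _)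
  have hr0 : 0 ≤ ∑' k, ((1 / 2 : ℝ) ^ k) • a (φ k) := tsum_nonneg hterm
  have hrn : ‖∑' k, ((1 / 2 : ℝ) ^ k) • a (φ k)‖ ≤ 2 * R := by
    refine tsum_of_norm_bounded (g := fun k => (1 / 2 : ℝ) ^ k * R)
      (hasSum_geometric_two.mul_right R) fun k => ?_
    rw [norm_smul, norm_pow, Real.norm_of_nonneg (by norm_num)]
    exact mul_le_mul_of_nonneg_left (hR _ (haS _)) (by positivity)
  -- One term of the series gives `a (φ k) ≤ (2 ^ k / t) • r`. The sum `s k` contains `a (φ j)` for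
  -- all `j < k`, because `φ j = p (j + 1) ≤ p k`.
  obtain ⟨x, hx, hx'⟩ := exists_disjointSeq_of_le_smul (z := fun k => a (φ k))
    (s := fun k => ∑ i ∈ Finset.range (p k + 1), a i)
    (r := t • ∑' k, ((1 / 2 : ℝ) ^ k) • a (φ k)) (c := fun k => 2 ^ k / t)
    (g := fun k => g (φ k)) (ε := ε) (fun k => ha0 _)
    (fun k => Finset.sum_nonneg fun i _ => ha0 i) (smul_nonneg ht.le hr0)
    (fun k => by positivity)
    (fun k => by
      rw [smul_smul, div_mul_cancel₀ _ ht.ne']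
      have h := smul_le_smul_of_nonneg_left
        (hsum.le_tsum k fun j _ => hterm j) (by positivity : (0 : ℝ) ≤ 2 ^ k)
      rwa [smul_smul, ← mul_pow, mul_one_div_cancel two_ne_zero, one_pow, one_smul] at h)
    (fun j k hjk => by
      refine Finset.single_le_sum (f := a) (fun i _ => ha0 i) (Finset.mem_range.2 ?_)
      exact Nat.lt_succ_of_le (hpmono.monotone hjk))
    (fun k => hg _) (fun k => by simpa [φ, hp] using hν2 (p k))
    (fun k => by
      have h := hν3 (p k)
      rw [← hp] at h
      refine le_trans (mul_le_mul_of_nonneg_right ?_ ?_) h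
      · gcongr
        · norm_num
        · exact (hpmono.id_le k).trans (Nat.le_succ _)
      · exact StrongDual.nonneg_apply (hg _) (Finset.sum_nonneg fun i _ => ha0 i))
    (fun k => by
      refine (StrongDual.apply_le (hM _) _).trans (le_trans ?_ htε)
      rw [norm_smul, Real.norm_of_nonneg ht.le]
      gcongr)
  refine ⟨φ, x, hφ, hx, fun k => ⟨(hx' k).1, hS (haS (φ k)) ?_, (hx' k).2.2⟩⟩
  rw [abs_of_nonneg (hx' k).1, abs_of_nonneg (ha0 _)]
  exact (hx' k).2.1

end NormedLattice

/-! ### Order intervals and uniform convergence on L-weakly compact sets -/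

section OrderContinuity

variable {E : Type*} [NormedAddCommGroup E] [Lattice E] [HasSolidNorm E] [IsOrderedAddMonoid E]
  [NormedSpace ℝ E] [IsOrderedModule ℝ E]

omit [IsOrderedModule ℝ E] in
-- Otherwise increments can be chained: for each `K` some `w m - w 0` has `f n`-value at least `K *
-- δ` for all large `n`, while these values never exceed `‖u‖`.
theorem exists_frequently_apply_sub_lt {u : E} {w : ℕ → E}
    (h0 : ∀ n, 0 ≤ w n) (hle : ∀ n, w n ≤ u) {f : ℕ → StrongDual ℝ E} (hf : ∀ n, 0 ≤ f n)
    (hf1 : ∀ n, ‖f n‖ ≤ 1) {δ : ℝ} (hδ : 0 < δ) :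
    ∃ N, ∀ m, N ≤ m → ∃ᶠ n in atTop, f n (w m - w N) < δ := by
  by_contra! H
  choose μ hμ hμδ using H
  let p : ℕ → ℕ := fun k => μ^[k] 0
  have hp (k : ℕ) : p (k + 1) = μ (p k) := Function.iterate_succ_apply' μ k 0
  have key (K : ℕ) : ∀ᶠ n in atTop, K * δ ≤ f n (w (p K) - w 0) := by
    induction K with
    | zero => simp [p]
    | succ K ih =>
      filter_upwards [ih, hμδ (p K)] with n h1 h2
      rw [← hp] at h2
      have : w (p (K + 1)) - w 0 = (w (p (K + 1)) - w (p K)) + (w (p K) - w 0) := by abel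
      rw [this, map_add]
      push_cast
      linarith
  obtain ⟨K, hK⟩ := exists_nat_gt (‖u‖ / δ)
  obtain ⟨n, hn⟩ := (key K).exists
  have h1 : f n (w (p K) - w 0) ≤ 1 * ‖u‖ :=
    (StrongDual.mono_of_nonneg (hf n) ((sub_le_self _ (h0 0)).trans (hle _))).trans
      (StrongDual.apply_le (hf1 n) u)
  rw [div_lt_iff₀ hδ] at hK
  linarith

/-- If the disjoint sequences in `[0, u]` are norm null, the increasing sequences in `[0, u]` are
Cauchy. -/
theorem cauchySeq_of_monotone_of_disjointSeq_tendsto {u : E}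
    (hu : ∀ x : ℕ → E, (∀ n, 0 ≤ x n ∧ x n ≤ u) → DisjointSeq x →
      Tendsto (fun n => ‖x n‖) atTop (𝓝 0))
    {w : ℕ → E} (hmono : Monotone w) (h0 : ∀ n, 0 ≤ w n) (hle : ∀ n, w n ≤ u) : CauchySeq w := by
  by_contra hcau
  rw [Metric.cauchySeq_iff'] at hcau
  push Not at hcau
  obtain ⟨ε', hε', hcau⟩ := hcau
  choose ν hν hνε using hcau
  obtain ⟨ε, hε, hεε'⟩ := exists_between hε'
  have hv0 (n : ℕ) : 0 ≤ w (ν n) - w n := sub_nonneg.2 (hmono (hν n))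
  -- The increments are bounded below in norm; functionals norming them feed the disjointification.
  choose f hf hf1 hfv using fun n => exists_nonneg_norming (w (ν n) - w n) (hv0 n)
  have hu0 : 0 ≤ u := (h0 0).trans (hle 0)
  obtain ⟨C, hC, hCu⟩ : ∃ C : ℝ, 0 < C ∧ C⁻¹ * ‖u‖ ≤ ε / 4 := by
    refine ⟨(‖u‖ + 1) / (ε / 4), by positivity, ?_⟩
    rw [inv_div, div_mul_eq_mul_div]
    rw [div_le_iff₀ (by positivity)]
    nlinarith [norm_nonneg u]
  obtain ⟨N, hN⟩ := exists_frequently_apply_sub_lt h0 hle hf hf1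
    (show 0 < ε / 4 / C by positivity)
  -- The next index lies beyond the previous increment, and its functional is small on `w (ν m) - w
  -- N`, which dominates all increments chosen so far. The guard `N ≤ m` only makes the choice
  -- total.
  have hnext (m : ℕ) : ∃ n, max N (ν m) ≤ n ∧ (N ≤ m → f n (w (ν m) - w N) < ε / 4 / C) := by
    by_cases hm : N ≤ m
    · obtain ⟨n, h1, h2⟩ := ((hN (ν m) (hm.trans (hν m))).and_eventually
        (eventually_ge_atTop (max N (ν m)))).exists
      exact ⟨n, h2, fun _ => h1⟩
    · exact ⟨_, le_rfl, fun h => absurd h hm⟩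
  choose η hη hηδ using hnext
  let p : ℕ → ℕ := fun k => η^[k] N
  have hp (k : ℕ) : p (k + 1) = η (p k) := Function.iterate_succ_apply' η k N
  have hNp (k : ℕ) : N ≤ p k := by
    cases k with
    | zero => exact le_rfl
    | succ k => rw [hp]; exact (le_max_left _ _).trans (hη _)
  have hνp (k : ℕ) : ν (p k) ≤ p (k + 1) := by
    rw [hp]; exact (le_max_right _ _).trans (hη _)
  have hνmono : Monotone fun k => ν (p k) :=
    monotone_nat_of_le_succ fun k => (hνp k).trans (hν _)
  obtain ⟨x, hx, hx'⟩ := exists_disjointSeq_of_le_smul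
    (z := fun k => w (ν (p (k + 1))) - w (p (k + 1))) (s := fun k => w (ν (p k)) - w N)
    (r := C⁻¹ • u) (c := fun _ => C) (g := fun k => f (p (k + 1))) (ε := ε)
    (fun k => hv0 _) (fun k => sub_nonneg.2 (hmono ((hNp k).trans (hν _))))
    (smul_nonneg (inv_nonneg.2 hC.le) hu0) (fun _ => hC)
    (fun k => by
      rw [smul_smul, mul_inv_cancel₀ hC.ne', one_smul]
      exact (sub_le_self _ (h0 _)).trans (hle _))
    (fun j k hjk => sub_le_sub (hmono (hνmono (Nat.succ_le_of_lt hjk))) (hmono (hNp _)))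
    (fun k => hf _)
    (fun k => by
      refine hεε'.trans_le (le_trans ?_ (hfv _))
      rw [← dist_eq_norm]
      exact hνε _)
    (fun k => by
      have h := hηδ (p k) (hNp k)
      rw [← hp, lt_div_iff₀ hC] at h
      linarith)
    (fun k => by
      refine (StrongDual.apply_le (hf1 _) _).trans ?_
      rw [norm_smul, norm_inv, Real.norm_of_nonneg hC.le, one_mul]
      exact hCu)
  have hlim := hu x (fun k => ⟨(hx' k).1,
    (hx' k).2.1.trans ((sub_le_self _ (h0 _)).trans (hle _))⟩) hx
  obtain ⟨k, hk⟩ := (hlim.eventually_lt_const (half_pos hε)).exists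
  have h1 := (hx' k).2.2
  have h2 := StrongDual.apply_le (hf1 (p (k + 1))) (x k)
  linarith

omit [IsOrderedModule ℝ E] in
theorem dual_inf_apply (f g : StrongDual ℝ E) (u : E) :
    (f ⊓ g) u = (2⁻¹ : ℝ) * (f u + g u - |f - g| u) := by
  rw [DualLattice.abs_eq_modulus]
  rfl

/-- One half of the Riesz–Kantorovich formula for `f ⊓ g`. -/
theorem exists_split_of_inf_apply_lt {f g : StrongDual ℝ E} {u : E} (hu : 0 ≤ u) {δ : ℝ}
    (h : (f ⊓ g) u < δ) : ∃ y, 0 ≤ y ∧ y ≤ u ∧ f (u - y) + g y < δ := by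
  rw [dual_inf_apply] at h
  obtain ⟨y, hy, hfy⟩ := exists_lt_of_lt_abs_apply (f := f - g) hu
    (c := f u + g u - 2 * δ) (by linarith)
  rw [abs_le'] at hy
  -- At the midpoint `(u + y) / 2` the split value is `(f u + g u - (f - g) y) / 2`, and `y` nearly
  -- attains `|f - g| u`.
  refine ⟨(2⁻¹ : ℝ) • (u + y), ?_, ?_, ?_⟩
  · exact smul_nonneg (by norm_num) (neg_le_iff_add_nonneg.1 hy.2)
  · have h1 : u + y ≤ (2 : ℝ) • u := by
      rw [two_smul]
      exact add_le_add_right hy.1 u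
    have := smul_le_smul_of_nonneg_left h1 (by norm_num : (0 : ℝ) ≤ 2⁻¹)
    rwa [smul_smul, inv_mul_cancel₀ two_ne_zero, one_smul] at this
  · simp only [map_sub, map_add, map_smul, smul_eq_mul, sub_apply] at hfy ⊢
    linarith

variable [CompleteSpace E]

/-- If this fails, there are `y k ∈ [0, u]` on which one functional is large and all earlier chosen
ones are tiny. The tail suprema `s k` of `y` exist as norm limits and decrease to a norm limit. The
functional large on `y k` is small on `s (k + 1)`, so it cannot be bounded on the vanishing
difference `s k - s (k + 1)`. -/
theorem tendsto_abs_apply_of_uawNull {u : E} (hu0 : 0 ≤ u)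
    (hu : ∀ x : ℕ → E, (∀ n, 0 ≤ x n ∧ x n ≤ u) → DisjointSeq x →
      Tendsto (fun n => ‖x n‖) atTop (𝓝 0))
    {f : ℕ → StrongDual ℝ E} {M : ℝ} (hM : ∀ n, ‖f n‖ ≤ M) (hf : UawNull f) :
    Tendsto (fun n => |f n| u) atTop (𝓝 0) := by
  have hg0 (n : ℕ) : 0 ≤ |f n| := abs_nonneg _
  have hgM (n : ℕ) : ‖|f n|‖ ≤ M := by rw [norm_abs_eq_norm]; exact hM n
  have hgu (n : ℕ) : 0 ≤ |f n| u := StrongDual.nonneg_apply (hg0 n) hu0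
  by_contra hnot
  obtain ⟨ε, hε, hfreq⟩ := exists_frequently_lt_of_not_tendsto_zero hgu hnot
  have hnext (m : ℕ) : ∃ n y, m < n ∧ 0 ≤ y ∧ y ≤ u ∧ ε / 2 < |f n| y ∧
      (∑ i ∈ Finset.range (m + 1), |f i|) y ≤ (1 / 2) ^ m := by
    have hsum : 0 ≤ ∑ i ∈ Finset.range (m + 1), |f i| := Finset.sum_nonneg fun i _ => hg0 i
    -- Uaw-nullity is tested against the sum of the earlier moduli, with evaluation at `u` as the
    -- functional on the dual.
    have hlim := hf _ hsum (NormedSpace.inclusionInDoubleDual ℝ E u)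
    simp only [NormedSpace.dual_def] at hlim
    have hδ : 0 < min (ε / 2) ((1 / 2 : ℝ) ^ m) := by positivity
    obtain ⟨n, h1, h2, h3⟩ := (hfreq.and_eventually ((hlim.eventually_lt_const hδ).and
      (eventually_gt_atTop m))).exists
    obtain ⟨y, hy0, hyu, hy⟩ := exists_split_of_inf_apply_lt hu0 h2
    have h4 := StrongDual.nonneg_apply (hg0 n) (sub_nonneg.2 hyu)
    have h5 := StrongDual.nonneg_apply hsum hy0
    have h6 := min_le_left (ε / 2) ((1 / 2 : ℝ) ^ m)
    have h7 := min_le_right (ε / 2) ((1 / 2 : ℝ) ^ m)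
    refine ⟨n, y, h3, hy0, hyu, ?_, by linarith⟩
    rw [map_sub] at h4 hy
    linarith
  choose ν Y hν hY0 hYu hνY hYs using hnext
  let p : ℕ → ℕ := fun k => ν^[k] 0
  have hp (k : ℕ) : p (k + 1) = ν (p k) := Function.iterate_succ_apply' ν k 0
  have hpmono : StrictMono p := strictMono_nat_of_lt_succ fun k => by
    rw [hp]; exact hν _
  let y : ℕ → E := fun k => Y (p k)
  have hy1 (k : ℕ) : ε / 2 < |f (p (k + 1))| (y k) := by rw [hp]; exact hνY _
  have hy2 (i j : ℕ) (hij : i ≤ j) : |f (p i)| (y j) ≤ (1 / 2) ^ j := by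
    have h1 : |f (p i)| ≤ ∑ l ∈ Finset.range (p j + 1), |f l| :=
      Finset.single_le_sum (f := fun l => |f l|) (fun l _ => hg0 l)
        (Finset.mem_range.2 (Nat.lt_succ_of_le (hpmono.monotone hij)))
    refine (h1 _ (hY0 _)).trans ((hYs _).trans ?_)
    exact pow_le_pow_of_le_one (by norm_num) (by norm_num) (hpmono.id_le j)
  let S : ℕ → ℕ → E := fun k => partialSups fun j => y (k + j)
  have hS0 (k n : ℕ) : 0 ≤ S k n := (hY0 _).trans (le_partialSups_of_le (fun j => y (k + j))
    (Nat.zero_le n))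
  have hSu (k n : ℕ) : S k n ≤ u := partialSups_le _ _ _ fun j _ => hYu _
  have hScau (k : ℕ) : CauchySeq (S k) :=
    cauchySeq_of_monotone_of_disjointSeq_tendsto hu (partialSups_monotone _) (hS0 k) (hSu k)
  choose s hs using fun k => cauchySeq_tendsto_of_complete (hScau k)
  have hs0 (k : ℕ) : 0 ≤ s k := ge_of_tendsto' (hs k) (hS0 k)
  have hsu (k : ℕ) : s k ≤ u := le_of_tendsto' (hs k) (hSu k)
  have hys (k : ℕ) : y k ≤ s k := ge_of_tendsto' (hs k) fun n =>
    le_partialSups_of_le (fun j => y (k + j)) (Nat.zero_le n)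
  have hsanti (k : ℕ) : s (k + 1) ≤ s k := by
    refine le_of_tendsto_of_tendsto' (hs (k + 1)) ((tendsto_add_atTop_iff_nat 1).2 (hs k))
      fun n => partialSups_le _ _ _ fun j hj => ?_
    have := le_partialSups_of_le (fun j => y (k + j)) (Nat.succ_le_succ hj)
    rwa [show k + 1 + j = k + (j + 1) by omega]
  -- Passing to `u - s k` turns the decreasing sequence into an increasing one in `[0, u]`.
  have hcau : CauchySeq fun k => u - s k := by
    refine cauchySeq_of_monotone_of_disjointSeq_tendsto hu
      (monotone_nat_of_le_succ fun k => sub_le_sub_left (hsanti k) u)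
      (fun k => sub_nonneg.2 (hsu k)) fun k => sub_le_self _ (hs0 k)
  have hdiff : Tendsto (fun k => ‖s k - s (k + 1)‖) atTop (𝓝 0) := by
    obtain ⟨l, hl⟩ := cauchySeq_tendsto_of_complete hcau
    have h := (((tendsto_add_atTop_iff_nat 1).2 hl).sub hl).norm
    simpa using h
  have hsmall (k : ℕ) : |f (p (k + 1))| (s (k + 1)) ≤ 2 * (1 / 2) ^ (k + 1) := by
    refine le_of_tendsto' ((|f (p (k + 1))|.continuous.tendsto _).comp (hs (k + 1))) fun n => ?_
    have h1 : S (k + 1) n ≤ ∑ j ∈ Finset.range (n + 1), y (k + 1 + j) :=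
      partialSups_le _ _ _ fun j hj => Finset.single_le_sum (f := fun j => y (k + 1 + j))
        (fun j _ => hY0 _) (Finset.mem_range.2 (Nat.lt_succ_of_le hj))
    have h2 : ∑ j ∈ Finset.range (n + 1), (1 / 2 : ℝ) ^ j ≤ 2 := by
      exact (summable_geometric_two.sum_le_tsum _ fun i _ => by positivity).trans_eq
        tsum_geometric_two
    calc |f (p (k + 1))| (S (k + 1) n)
        ≤ |f (p (k + 1))| (∑ j ∈ Finset.range (n + 1), y (k + 1 + j)) :=
          StrongDual.mono_of_nonneg (hg0 _) h1
      _ ≤ ∑ j ∈ Finset.range (n + 1), (1 / 2 : ℝ) ^ (k + 1 + j) := by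
          rw [map_sum]
          exact Finset.sum_le_sum fun j _ => hy2 _ _ (Nat.le_add_right _ _)
      _ ≤ 2 * (1 / 2) ^ (k + 1) := by
          simp_rw [pow_add _ (k + 1)]
          rw [← Finset.mul_sum, mul_comm]
          gcongr
  -- From `y k ≤ s k = s (k + 1) + (s k - s (k + 1))`.
  have hbound (k : ℕ) : ε / 2 ≤ 2 * (1 / 2) ^ (k + 1) + M * ‖s k - s (k + 1)‖ := by
    have h1 := StrongDual.mono_of_nonneg (hg0 (p (k + 1))) (hys k)
    have h2 := StrongDual.apply_le (hgM (p (k + 1))) (s k - s (k + 1))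
    rw [map_sub] at h2
    linarith [hy1 k, hsmall k]
  have hlim : Tendsto (fun k => 2 * (1 / 2 : ℝ) ^ (k + 1) + M * ‖s k - s (k + 1)‖) atTop
      (𝓝 (2 * 0 + M * 0)) :=
    (((tendsto_add_atTop_iff_nat 1).2 (tendsto_pow_atTop_nhds_zero_of_lt_one (by norm_num)
      (by norm_num))).const_mul 2).add (hdiff.const_mul M)
  have := ge_of_tendsto' hlim hbound
  linarith

/-- Norm bounded uaw-null sequences of functionals tend to zero uniformly on L-weakly compact sets. -/
theorem IsLWeaklyCompact.tendsto_abs_apply_abs {B : Set E} (hB : IsLWeaklyCompact B)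
    {f : ℕ → StrongDual ℝ E} (hfb : Bornology.IsBounded (Set.range f)) (hf : UawNull f)
    {z : ℕ → E} (hz : ∀ n, z n ∈ B) : Tendsto (fun n => |f n| |z n|) atTop (𝓝 0) := by
  obtain ⟨M, hM⟩ := hfb.exists_norm_le
  replace hM (n : ℕ) : ‖f n‖ ≤ M := hM _ ⟨n, rfl⟩
  have hgM (n : ℕ) : ‖|f n|‖ ≤ M := by rw [norm_abs_eq_norm]; exact hM n
  have hg0 (n : ℕ) : 0 ≤ |f n| := abs_nonneg _
  obtain ⟨-, hBb, hBd⟩ := hB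
  have hSb : Bornology.IsBounded (LatticeOrderedAddCommGroup.solidClosure B) := by
    obtain ⟨R, hR⟩ := hBb.exists_norm_le
    refine isBounded_iff_forall_norm_le.2 ⟨R, ?_⟩
    rintro x ⟨y, hy, hxy⟩
    exact (norm_le_norm_of_abs_le_abs hxy).trans (hR y hy)
  have hSs := LatticeOrderedAddCommGroup.isSolid_solidClosure B
  have hzS (n : ℕ) : |z n| ∈ LatticeOrderedAddCommGroup.solidClosure B :=
    ⟨z n, hz n, (abs_abs (z n)).le⟩
  by_contra hnot
  obtain ⟨ε, hε, hfreq⟩ := exists_frequently_lt_of_not_tendsto_zero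
    (fun n => StrongDual.nonneg_apply (hg0 n) (abs_nonneg (z n))) hnot
  obtain ⟨φ, x, -, hx, hx'⟩ := exists_disjoint_subseq hSs hSb hg0 hgM
    (fun a ha ha0 => tendsto_abs_apply_of_uawNull ha0
      (fun x hx hxd => hBd x (fun n => hSs ha (by
        rw [abs_of_nonneg (hx n).1, abs_of_nonneg ha0]; exact (hx n).2)) hxd) hM hf)
    hzS (fun n => abs_nonneg _) hε hfreq
  have hlim := (hBd x (fun k => (hx' k).2.1) hx).const_mul M
  rw [mul_zero] at hlim
  obtain ⟨k, hk⟩ := (hlim.eventually_lt_const (half_pos hε)).exists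
  have h1 := (hx' k).2.2
  have h2 := StrongDual.apply_le (hgM (φ k)) (x k)
  linarith

end OrderContinuity

/-! ### Components of functionals carried by bands -/

section Component

variable {E : Type*} [NormedAddCommGroup E] [Lattice E] [HasSolidNorm E] [IsOrderedAddMonoid E]
  [NormedSpace ℝ E] {g : StrongDual ℝ E} {y : E}

/-- For `g, y ≥ 0` and `x ≥ 0`, the value at `x` of the component of `g` carried by the band
generated by `y`; extended to all `x` through `|x|`. -/
noncomputable def bandComponent (g : StrongDual ℝ E) (y x : E) : ℝ :=
  ⨆ k : ℕ, g (|x| ⊓ (k : ℝ) • y)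

theorem le_bandComponent (hg : 0 ≤ g) (x : E) (k : ℕ) :
    g (|x| ⊓ (k : ℝ) • y) ≤ bandComponent g y x := by
  refine le_ciSup (f := fun k : ℕ => g (|x| ⊓ (k : ℝ) • y)) ⟨g |x|, ?_⟩ k
  rintro _ ⟨j, rfl⟩
  exact StrongDual.mono_of_nonneg hg inf_le_left

theorem bandComponent_le_apply_abs (hg : 0 ≤ g) (x : E) : bandComponent g y x ≤ g |x| :=
  ciSup_le fun _ => StrongDual.mono_of_nonneg hg inf_le_left

theorem bandComponent_mono (hg : 0 ≤ g) {x x' : E} (h : |x| ≤ |x'|) :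
    bandComponent g y x ≤ bandComponent g y x' :=
  ciSup_le fun k => (StrongDual.mono_of_nonneg hg (inf_le_inf_right _ h)).trans
    (le_bandComponent hg x' k)

variable [IsOrderedModule ℝ E]

omit [HasSolidNorm E] [IsOrderedAddMonoid E] in
theorem natCast_smul_nonneg (hy : 0 ≤ y) (k : ℕ) : 0 ≤ (k : ℝ) • y :=
  smul_nonneg k.cast_nonneg hy

theorem bandComponent_nonneg (hg : 0 ≤ g) (hy : 0 ≤ y) (x : E) : 0 ≤ bandComponent g y x :=
  (StrongDual.nonneg_apply hg (le_inf (abs_nonneg x) (natCast_smul_nonneg hy 0))).trans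
    (le_bandComponent hg x 0)

theorem bandComponent_add_le (hg : 0 ≤ g) (hy : 0 ≤ y) (x x' : E) :
    bandComponent g y (x + x') ≤ bandComponent g y x + bandComponent g y x' := by
  refine ciSup_le fun k => ?_
  refine le_trans ?_ (add_le_add (le_bandComponent hg x k) (le_bandComponent hg x' k))
  rw [← map_add]
  exact StrongDual.mono_of_nonneg hg ((inf_le_inf_right _ (abs_add_le x x')).trans
    (add_inf_le_inf_add_inf (abs_nonneg x) (abs_nonneg x') (natCast_smul_nonneg hy k)))

omit [HasSolidNorm E] [IsOrderedAddMonoid E] in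
theorem abs_smul_of_pos {c : ℝ} (hc : 0 < c) (x : E) : |c • x| = c • |x| := by
  have h := (OrderIso.smulRight hc : E ≃o E).map_sup x (-x)
  simp only [OrderIso.smulRight_apply, smul_neg] at h
  exact h.symm

theorem bandComponent_smul_le (hg : 0 ≤ g) (hy : 0 ≤ y) {c : ℝ} (hc : 0 < c) (x : E) :
    bandComponent g y (c • x) ≤ c * bandComponent g y x := by
  refine ciSup_le fun k => ?_
  obtain ⟨j, hj⟩ := exists_nat_ge (c⁻¹ * k)
  have h1 : (k : ℝ) • y ≤ c • (j : ℝ) • y := by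
    rw [smul_smul]
    refine smul_le_smul_of_nonneg_right ?_ hy
    rwa [inv_mul_le_iff₀ hc] at hj
  calc g (|c • x| ⊓ (k : ℝ) • y) ≤ g (c • (|x| ⊓ (j : ℝ) • y)) := by
        refine StrongDual.mono_of_nonneg hg ?_
        rw [smul_inf_of_pos hc, abs_smul_of_pos hc]
        exact inf_le_inf_left _ h1
    _ ≤ c * bandComponent g y x := by
        rw [map_smul, smul_eq_mul]
        exact mul_le_mul_of_nonneg_left (le_bandComponent hg x j) hc.le

theorem bandComponent_smul (hg : 0 ≤ g) (hy : 0 ≤ y) {c : ℝ} (hc : 0 < c) (x : E) :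
    bandComponent g y (c • x) = c * bandComponent g y x := by
  refine le_antisymm (bandComponent_smul_le hg hy hc x) ?_
  have h := bandComponent_smul_le hg hy (inv_pos.2 hc) (c • x)
  rwa [smul_smul, inv_mul_cancel₀ hc.ne', one_smul, ← div_eq_inv_mul, le_div_iff₀' hc] at h

/-- `bandComponent g y` is sublinear, so Hahn–Banach extends the functional on the line through `z`
that takes the required value at `z`. -/
theorem exists_le_bandComponent (hg : 0 ≤ g) (hy : 0 ≤ y) (z : E) :
    ∃ f : StrongDual ℝ E, (∀ x, f x ≤ bandComponent g y x) ∧ f z = bandComponent g y z := by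
  obtain ⟨f, hfz, hf⟩ : ∃ f : E →ₗ[ℝ] ℝ, f z = bandComponent g y z ∧
      ∀ x, f x ≤ bandComponent g y x := by
    rcases eq_or_ne z 0 with rfl | hz
    · refine ⟨0, le_antisymm (bandComponent_nonneg hg hy _) ?_,
        fun x => bandComponent_nonneg hg hy x⟩
      simpa using bandComponent_le_apply_abs (y := y) hg 0
    · obtain ⟨f, hf1, hf2⟩ := exists_extension_of_le_sublinear
        (LinearPMap.mkSpanSingleton (K := ℝ) z (bandComponent g y z) hz) (bandComponent g y)
        (fun c hc x => bandComponent_smul hg hy hc x) (bandComponent_add_le hg hy) (by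
          rintro ⟨x, hx⟩
          obtain ⟨c, rfl⟩ := Submodule.mem_span_singleton.1 hx
          refine (LinearPMap.mkSpanSingleton'_apply (σ := RingHom.id ℝ) z _ _ c hx).trans_le ?_
          rw [RingHom.id_apply, smul_eq_mul]
          rcases lt_trichotomy c 0 with hc | rfl | hc
          · refine le_trans ?_ (bandComponent_nonneg hg hy _)
            exact mul_nonpos_of_nonpos_of_nonneg hc.le (bandComponent_nonneg hg hy _)
          · simpa using bandComponent_nonneg hg hy _
          · exact (bandComponent_smul hg hy hc z).ge)
      refine ⟨f, ?_, hf2⟩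
      have h := hf1 ⟨z, Submodule.mem_span_singleton_self z⟩
      exact h.trans (LinearPMap.mkSpanSingleton_apply ℝ ℝ hz (bandComponent g y z))
  have hle (x : E) : f x ≤ ‖g‖ * ‖x‖ := (hf x).trans <|
    (bandComponent_le_apply_abs hg x).trans <| by
      simpa [norm_abs_eq_norm] using StrongDual.apply_le (le_refl ‖g‖) |x|
  refine ⟨f.mkContinuous ‖g‖ fun x => ?_, hf, hfz⟩
  rw [Real.norm_eq_abs, abs_le']
  refine ⟨hle x, ?_⟩
  simpa using hle (-x)

omit [IsOrderedModule ℝ E] in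
theorem abs_apply_le_bandComponent {f : StrongDual ℝ E} (hg : 0 ≤ g)
    (hf : ∀ x, f x ≤ bandComponent g y x) {x : E} (hx : 0 ≤ x) :
    |f| x ≤ bandComponent g y x := by
  rw [DualLattice.abs_eq_modulus, DualLattice.modulus_apply f hx]
  exact DualLattice.posModulus_le f hx fun w hw => (hf w).trans
    (bandComponent_mono hg (by rwa [abs_of_nonneg hx]))

omit [IsOrderedModule ℝ E] in
-- Choose `k` nearly attaining the supremum: adding `x ⊓ k • y` to the `j`-th truncation of the
-- remainder stays below `x ⊓ (j + k) • y`.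
theorem exists_bandComponent_sub_le (hg : 0 ≤ g) {x : E} (hx : 0 ≤ x) {ε : ℝ}
    (hε : 0 < ε) : ∃ k : ℕ, bandComponent g y (x - x ⊓ (k : ℝ) • y) ≤ ε := by
  obtain ⟨k, hk⟩ := exists_lt_of_lt_ciSup (f := fun k : ℕ => g (|x| ⊓ (k : ℝ) • y))
    (show bandComponent g y x - ε < bandComponent g y x by linarith)
  refine ⟨k, ciSup_le fun j => ?_⟩
  rw [abs_of_nonneg hx] at hk
  rw [abs_of_nonneg (sub_nonneg.2 inf_le_left)]
  have h : (x - x ⊓ (k : ℝ) • y) ⊓ (j : ℝ) • y + x ⊓ (k : ℝ) • y ≤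
      |x| ⊓ ((j + k : ℕ) : ℝ) • y := by
    rw [abs_of_nonneg hx]
    refine le_inf ?_ ?_
    · exact (add_le_add_left inf_le_left _).trans_eq (sub_add_cancel _ _)
    · rw [Nat.cast_add, add_smul]
      exact add_le_add inf_le_right inf_le_right
  have h1 := (StrongDual.mono_of_nonneg hg h).trans (le_bandComponent hg x (j + k))
  rw [map_add] at h1
  linarith

/-- Split `x` at `x ⊓ k • y₁`: `|f₁|` is small on the remainder, and `|f₂|` vanishes on `x ⊓ k •
y₁`, which is disjoint from `y₂`. -/
theorem abs_inf_abs_eq_zero_of_le_bandComponent {g₁ g₂ f₁ f₂ : StrongDual ℝ E} {y₁ y₂ : E}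
    (hg₁ : 0 ≤ g₁) (hg₂ : 0 ≤ g₂) (hy₁ : 0 ≤ y₁) (hy₂ : 0 ≤ y₂) (hy : y₁ ⊓ y₂ = 0)
    (hf₁ : ∀ x, f₁ x ≤ bandComponent g₁ y₁ x) (hf₂ : ∀ x, f₂ x ≤ bandComponent g₂ y₂ x) :
    |f₁| ⊓ |f₂| = 0 := by
  refine le_antisymm (fun x hx => ?_) (le_inf (abs_nonneg _) (abs_nonneg _))
  refine le_of_forall_pos_le_add fun ε hε => ?_
  obtain ⟨k, hk⟩ := exists_bandComponent_sub_le hg₁ hx hε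
  have hw : 0 ≤ x ⊓ (k : ℝ) • y₁ := le_inf hx (natCast_smul_nonneg hy₁ k)
  have hxw : 0 ≤ x - x ⊓ (k : ℝ) • y₁ := sub_nonneg.2 inf_le_left
  have h1 : (|f₁| ⊓ |f₂|) (x - x ⊓ (k : ℝ) • y₁) ≤ ε :=
    ((inf_le_left : |f₁| ⊓ |f₂| ≤ |f₁|) _ hxw).trans
      ((abs_apply_le_bandComponent hg₁ hf₁ hxw).trans hk)
  have h2 : (|f₁| ⊓ |f₂|) (x ⊓ (k : ℝ) • y₁) ≤ 0 := by
    refine ((inf_le_right : |f₁| ⊓ |f₂| ≤ |f₂|) _ hw).trans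
      ((abs_apply_le_bandComponent hg₂ hf₂ hw).trans (ciSup_le fun j => ?_))
    rw [abs_of_nonneg hw]
    have hM : (0 : ℝ) < k + j + 1 := by positivity
    have h3 : x ⊓ (k : ℝ) • y₁ ⊓ (j : ℝ) • y₂ ≤ 0 :=
      calc x ⊓ (k : ℝ) • y₁ ⊓ (j : ℝ) • y₂
          ≤ ((k : ℝ) + j + 1) • y₁ ⊓ ((k : ℝ) + j + 1) • y₂ := by
            refine inf_le_inf (inf_le_right.trans ?_) ?_
            · exact smul_le_smul_of_nonneg_right (by linarith [j.cast_nonneg (α := ℝ)]) hy₁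
            · exact smul_le_smul_of_nonneg_right (by linarith [k.cast_nonneg (α := ℝ)]) hy₂
        _ = 0 := by rw [← smul_inf_of_pos hM, hy, smul_zero]
    simpa using StrongDual.mono_of_nonneg hg₂ h3
  have h3 : (|f₁| ⊓ |f₂|) x = (|f₁| ⊓ |f₂|) (x - x ⊓ (k : ℝ) • y₁) +
      (|f₁| ⊓ |f₂|) (x ⊓ (k : ℝ) • y₁) := by
    rw [← map_add, sub_add_cancel]
  rw [h3, zero_apply]
  linarith

end Component

/-! ### L-weak compactness via uaw-null sequences of functionals -/

section Characterization

variable {E : Type*} [NormedAddCommGroup E] [Lattice E] [HasSolidNorm E] [IsOrderedAddMonoid E]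
  [NormedSpace ℝ E]

omit [HasSolidNorm E] [NormedSpace ℝ E] in
theorem DisjointSeq.of_abs_le {x y : ℕ → E} (hx : DisjointSeq x) (h : ∀ n, |y n| ≤ |x n|) :
    DisjointSeq y := fun m n hmn =>
  le_antisymm ((inf_le_inf (h m) (h n)).trans_eq (hx m n hmn))
    (le_inf (abs_nonneg _) (abs_nonneg _))

/-- The elements `|x n| ⊓ u` are disjoint in `[0, u]`, so their finite sums stay below `u`. Hence `∑
|φ| (|x n| ⊓ u)` converges and its terms tend to zero. -/
theorem DisjointSeq.uawNull {x : ℕ → E} (hx : DisjointSeq x) : UawNull x := by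
  intro u hu φ
  have hw0 (n : ℕ) : 0 ≤ |x n| ⊓ u := le_inf (abs_nonneg _) hu
  have hnn (n : ℕ) : 0 ≤ |φ| (|x n| ⊓ u) := StrongDual.nonneg_apply (abs_nonneg φ) (hw0 n)
  have hsum : Summable fun n => |φ| (|x n| ⊓ u) := by
    refine summable_of_sum_range_le (c := |φ| u) hnn fun N => ?_
    rw [← map_sum]
    refine StrongDual.mono_of_nonneg (abs_nonneg φ)
      (sum_le_of_pairwise_inf_eq_zero hu hw0 (fun n => inf_le_right) (fun m n hmn => ?_) N)
    exact le_antisymm ((inf_le_inf inf_le_left inf_le_left).trans_eq (hx m n hmn))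
      (le_inf (hw0 m) (hw0 n))
  refine squeeze_zero_norm (fun n => ?_) hsum.tendsto_atTop_zero
  have := abs_apply_le_abs_apply_abs φ (|x n| ⊓ u)
  rwa [abs_of_nonneg (hw0 n)] at this

omit [HasSolidNorm E] [IsOrderedAddMonoid E] in
theorem UawNull.comp_strictMono {x : ℕ → E} (hx : UawNull x) {φ : ℕ → ℕ} (hφ : StrictMono φ) :
    UawNull (x ∘ φ) := fun u hu ψ => (hx u hu ψ).comp hφ.tendsto_atTop

variable [IsOrderedModule ℝ E]

/-- A bounded set on which the norm bounded uaw-null sequences of functionals tend to zero uniformly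
is L-weakly compact. -/
theorem isLWeaklyCompact_of_uawNull {B : Set E} (hne : B.Nonempty)
    (hb : Bornology.IsBounded B)
    (h : ∀ f : ℕ → StrongDual ℝ E, Bornology.IsBounded (Set.range f) → UawNull f →
      ∀ z : ℕ → E, (∀ n, z n ∈ B) → Tendsto (fun n => f n (z n)) atTop (𝓝 0)) :
    IsLWeaklyCompact B := by
  refine ⟨hne, hb, fun y hy hyd => ?_⟩
  choose z hzB hyz using hy
  choose g hg hg1 hgy using fun n => exists_nonneg_norming |y n| (abs_nonneg (y n))
  choose f hf hfz using fun n => exists_le_bandComponent (hg n) (abs_nonneg (y n)) (z n)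
  have hfd : DisjointSeq f := fun m n hmn =>
    abs_inf_abs_eq_zero_of_le_bandComponent (hg m) (hg n) (abs_nonneg _) (abs_nonneg _)
      (hyd m n hmn) (hf m) (hf n)
  have hfle (n : ℕ) (x : E) : f n x ≤ 1 * ‖x‖ := (hf n x).trans <|
    (bandComponent_le_apply_abs (hg n) x).trans <| by
      simpa [norm_abs_eq_norm] using StrongDual.apply_le (hg1 n) |x|
  have hfb : Bornology.IsBounded (Set.range f) := by
    refine isBounded_iff_forall_norm_le.2 ⟨1, ?_⟩
    rintro _ ⟨n, rfl⟩
    refine (f n).opNorm_le_bound zero_le_one fun x => ?_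
    rw [Real.norm_eq_abs, abs_le']
    exact ⟨hfle n x, by simpa using hfle n (-x)⟩
  refine squeeze_zero (fun n => norm_nonneg _) (fun n => ?_) (h f hfb hfd.uawNull z hzB)
  rw [hfz]
  -- The truncation at `k = 1` is `|z n| ⊓ |y n| = |y n|`, on which `g n` is norming.
  refine le_trans ?_ (le_bandComponent (hg n) (z n) 1)
  rw [Nat.cast_one, one_smul, inf_eq_right.2 (hyz n), ← norm_abs_eq_norm]
  exact hgy n

theorem IsLWeaklyCompact.mono {F : Type*} [NormedAddCommGroup F] [Lattice F] {A B : Set F} (hB : IsLWeaklyCompact B) (hA : A.Nonempty)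
    (h : A ⊆ B) : IsLWeaklyCompact A :=
  ⟨hA, hB.2.1.subset h, fun x hx hxd => hB.2.2 x
    (fun n => let ⟨y, hy, hxy⟩ := hx n; ⟨y, h hy, hxy⟩) hxd⟩

end Characterization

/-! ### Operators and their adjoints -/

section Operator

variable {E F : Type*}
  [NormedAddCommGroup E] [Lattice E] [HasSolidNorm E] [IsOrderedAddMonoid E]
  [NormedSpace ℝ E] [IsOrderedModule ℝ E]
  [NormedAddCommGroup F] [Lattice F] [HasSolidNorm F] [IsOrderedAddMonoid F]
  [NormedSpace ℝ F] [IsOrderedModule ℝ F]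
  {T : E →L[ℝ] F}

omit [IsOrderedModule ℝ F] in
theorem tendsto_apply_of_abs_apply_abs {f : ℕ → StrongDual ℝ F} {z : ℕ → F}
    (h : Tendsto (fun n => |f n| |z n|) atTop (𝓝 0)) :
    Tendsto (fun n => f n (z n)) atTop (𝓝 0) :=
  squeeze_zero_norm (fun n => abs_apply_le_abs_apply_abs (f n) (z n)) h

omit [IsOrderedModule ℝ E] in
-- By the Riesz–Kantorovich formula, `|T' f n| x` is attained up to `(1 / 2) ^ n` at some `y n ∈
-- [-x, x]`, and `f n (T (y n))` tends to zero by uniform convergence.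
theorem tendsto_abs_adjointOp_apply [CompleteSpace F] {f : ℕ → StrongDual ℝ F} {x : E}
    (hx : 0 ≤ x) (hT : IsLWeaklyCompact (T '' Set.Icc (-x) x))
    (hfb : Bornology.IsBounded (Set.range f)) (hf : UawNull f) :
    Tendsto (fun n => |adjointOp T (f n)| x) atTop (𝓝 0) := by
  have hnn (n : ℕ) : 0 ≤ |adjointOp T (f n)| x := StrongDual.nonneg_apply (abs_nonneg _) hx
  have hex (n : ℕ) : ∃ y, |y| ≤ x ∧ |adjointOp T (f n)| x - (1 / 2) ^ n < f n (T y) :=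
    exists_lt_of_lt_abs_apply (f := adjointOp T (f n)) hx (sub_lt_self _ (by positivity))
  choose y hy hfy using hex
  have h1 := tendsto_apply_of_abs_apply_abs (hT.tendsto_abs_apply_abs hfb hf (z := fun n => T (y n))
    fun n => ⟨y n, mem_Icc_neg_iff_abs_le.2 (hy n), rfl⟩)
  have h2 : Tendsto (fun n : ℕ => (1 / 2 : ℝ) ^ n) atTop (𝓝 0) :=
    tendsto_pow_atTop_nhds_zero_of_lt_one (by norm_num) (by norm_num)
  have h3 := h1.add h2
  rw [add_zero] at h3
  exact squeeze_zero hnn (fun n => by linarith [hfy n]) h3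

/-- If `|T' f n|` does not tend to zero uniformly on `A`, disjointification in `E` gives a disjoint
positive sequence in `A` on which it stays large, contradicting the second hypothesis along a
subsequence of `f`. -/
theorem isLWeaklyCompact_image_of_tendsto [CompleteSpace E] {A : Set E} (hne : A.Nonempty)
    (hb : Bornology.IsBounded A) (hA : LatticeOrderedAddCommGroup.IsSolid A)
    (h : ∀ f : ℕ → StrongDual ℝ F, Bornology.IsBounded (Set.range f) → UawNull f →
      (∀ x ∈ A, 0 ≤ x → Tendsto (fun n => |adjointOp T (f n)| x) atTop (𝓝 0)) ∧
      (∀ x : ℕ → E, (∀ n, x n ∈ A ∧ 0 ≤ x n) → DisjointSeq x →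
        Tendsto (fun n => f n (T (x n))) atTop (𝓝 0))) :
    IsLWeaklyCompact (T '' A) := by
  refine isLWeaklyCompact_of_uawNull (hne.image T) (T.lipschitz.isBounded_image hb)
    fun f hfb hf z hz => ?_
  choose a haA haz using hz
  obtain ⟨M, hM⟩ := hfb.exists_norm_le
  have hg0 (n : ℕ) : 0 ≤ |adjointOp T (f n)| := abs_nonneg _
  have hgM (n : ℕ) : ‖|adjointOp T (f n)|‖ ≤ ‖adjointOp (E := E) T‖ * M := by
    rw [norm_abs_eq_norm]
    exact (adjointOp T).le_opNorm_of_le (hM _ ⟨n, rfl⟩)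
  have hlim : Tendsto (fun n => |adjointOp T (f n)| |a n|) atTop (𝓝 0) := by
    by_contra hnot
    obtain ⟨ε, hε, hfreq⟩ := exists_frequently_lt_of_not_tendsto_zero
      (fun n => StrongDual.nonneg_apply (hg0 n) (abs_nonneg (a n))) hnot
    obtain ⟨φ, x, hφ, hx, hx'⟩ := exists_disjoint_subseq hA hb hg0 hgM (h f hfb hf).1
      (fun n => hA (haA n) (abs_abs (a n)).le) (fun n => abs_nonneg (a n)) hε hfreq
    choose y hy hfy using fun k => exists_lt_of_lt_abs_apply (hx' k).1 (hx' k).2.2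
    have hxabs (k : ℕ) : |x k| = x k := abs_of_nonneg (hx' k).1
    -- The near-maximizers `y k ∈ [-x k, x k]` need not be positive, so the hypothesis is applied to
    -- `(y k)⁺` and `(y k)⁻` separately; both are disjoint sequences in `A` by solidity.
    have hpart (w : ℕ → E) (hw0 : ∀ k, 0 ≤ w k) (hwy : ∀ k, w k ≤ |y k|) :
        Tendsto (fun k => f (φ k) (T (w k))) atTop (𝓝 0) := by
      have hwx (k : ℕ) : |w k| ≤ |x k| := by
        rw [abs_of_nonneg (hw0 k), hxabs]
        exact (hwy k).trans (hy k)
      exact (h (f ∘ φ) (hfb.subset (Set.range_comp_subset_range φ f))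
        (hf.comp_strictMono hφ)).2 w (fun k => ⟨hA (hx' k).2.1 (hwx k), hw0 k⟩)
        (hx.of_abs_le hwx)
    have h1 := (hpart (fun k => (y k)⁺) (fun k => posPart_nonneg _) fun k => by
      rw [← posPart_add_negPart]
      exact le_add_of_nonneg_right (negPart_nonneg _)).sub
      (hpart (fun k => (y k)⁻) (fun k => negPart_nonneg _) fun k => by
      rw [← posPart_add_negPart]
      exact le_add_of_nonneg_left (posPart_nonneg _))
    rw [sub_zero] at h1
    obtain ⟨k, hk⟩ := (h1.eventually_lt_const (half_pos hε)).exists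
    rw [← map_sub, ← map_sub, posPart_sub_negPart] at hk
    exact hk.not_gt (hfy k)
  have h1 := tendsto_apply_of_abs_apply_abs hlim
  refine h1.congr fun n => ?_
  rw [← haz]
  rfl

omit [Lattice E] [HasSolidNorm E] [IsOrderedAddMonoid E] [IsOrderedModule ℝ E] in
theorem isUawDunfordPettis_adjointOp [CompleteSpace F]
    (hT : IsLWeaklyCompact (T '' Metric.closedBall 0 1)) :
    IsUawDunfordPettis (adjointOp T) := by
  intro f hfb hf
  have hex (n : ℕ) : ∃ y, ‖y‖ ≤ 1 ∧ ‖adjointOp T (f n)‖ - (1 / 2) ^ n ≤ |f n (T y)| := by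
    by_contra! H
    have hpos : (0 : ℝ) < (1 / 2) ^ n := by positivity
    -- The negated claim at `y = 0` gives the nonnegativity needed to use this number as an operator
    -- norm bound.
    have h0 : 0 ≤ ‖adjointOp T (f n)‖ - (1 / 2) ^ n := by
      have := H 0 (by simp)
      simp only [map_zero, abs_zero] at this
      exact this.le
    have := (adjointOp T (f n)).opNorm_le_of_unit_norm h0 fun y hy => (H y hy.le).le
    linarith
  choose y hy hfy using hex
  have h1 := (tendsto_apply_of_abs_apply_abs (hT.tendsto_abs_apply_abs hfb hf
    (z := fun n => T (y n)) fun n => ⟨y n, mem_closedBall_zero_iff.2 (hy n), rfl⟩)).abs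
  have h2 : Tendsto (fun n : ℕ => (1 / 2 : ℝ) ^ n) atTop (𝓝 0) :=
    tendsto_pow_atTop_nhds_zero_of_lt_one (by norm_num) (by norm_num)
  have h3 := h1.add h2
  rw [abs_zero, add_zero] at h3
  exact squeeze_zero (fun n => norm_nonneg _) (fun n => by linarith [hfy n]) h3

omit [Lattice E] [HasSolidNorm E] [IsOrderedAddMonoid E] [IsOrderedModule ℝ E]
  [IsOrderedModule ℝ F] in
theorem IsUawDunfordPettis.tendsto_apply (hT : IsUawDunfordPettis (adjointOp T))
    {f : ℕ → StrongDual ℝ F} (hfb : Bornology.IsBounded (Set.range f)) (hf : UawNull f) {R : ℝ}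
    {x : ℕ → E} (hx : ∀ n, ‖x n‖ ≤ R) : Tendsto (fun n => f n (T (x n))) atTop (𝓝 0) := by
  have h := (hT f hfb hf).mul_const R
  rw [zero_mul] at h
  exact squeeze_zero_norm (fun n => (adjointOp T (f n)).le_opNorm_of_le (hx n)) h

theorem IsUawDunfordPettis.isLWeaklyCompact_image (hT : IsUawDunfordPettis (adjointOp T))
    {A : Set E} (hne : A.Nonempty) (hb : Bornology.IsBounded A) : IsLWeaklyCompact (T '' A) := by
  obtain ⟨R, hR⟩ := hb.exists_norm_le
  refine isLWeaklyCompact_of_uawNull (hne.image T) (T.lipschitz.isBounded_image hb)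
    fun f hfb hf z hz => ?_
  choose a haA haz using hz
  simp_rw [← haz]
  exact hT.tendsto_apply hfb hf fun n => hR _ (haA n)

end Operator

/-! ### The two chains of equivalences -/

theorem mainTheorem12 {E F : Type*}
    [NormedAddCommGroup E] [Lattice E] [HasSolidNorm E] [IsOrderedAddMonoid E]
    [NormedSpace ℝ E] [IsOrderedModule ℝ E] [CompleteSpace E]
    [NormedAddCommGroup F] [Lattice F] [HasSolidNorm F] [IsOrderedAddMonoid F]
    [NormedSpace ℝ F] [IsOrderedModule ℝ F] [CompleteSpace F]
    (T : E →L[ℝ] F) :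
    (∀ A : Set E, A.Nonempty → Bornology.IsBounded A → LatticeOrderedAddCommGroup.IsSolid A →
      List.TFAE [
        IsLWeaklyCompact (T '' A),
        (∀ x ∈ A, 0 ≤ x → IsLWeaklyCompact (T '' Set.Icc (-x) x)) ∧
          (∀ x : ℕ → E, (∀ n, x n ∈ A ∧ 0 ≤ x n) → DisjointSeq x →
            IsLWeaklyCompact (Set.range fun n => T (x n))),
        ∀ f : ℕ → StrongDual ℝ F, Bornology.IsBounded (Set.range f) → UawNull f →
          (∀ x ∈ A, 0 ≤ x → Tendsto (fun n => |adjointOp T (f n)| x) atTop (𝓝 0)) ∧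
          (∀ x : ℕ → E, (∀ n, x n ∈ A ∧ 0 ≤ x n) → DisjointSeq x →
            Tendsto (fun n => f n (T (x n))) atTop (𝓝 0))]) ∧
    List.TFAE [
      IsUawDunfordPettis (adjointOp T),
      IsLWeaklyCompact (T '' Metric.closedBall 0 1),
      (∀ x : E, 0 ≤ x → IsLWeaklyCompact (T '' Set.Icc (-x) x)) ∧
        (∀ x : ℕ → E, (∀ n, x n ∈ Metric.closedBall 0 1 ∧ 0 ≤ x n) → DisjointSeq x →
          IsLWeaklyCompact (Set.range fun n => T (x n))),
      ∀ f : ℕ → StrongDual ℝ F, Bornology.IsBounded (Set.range f) → UawNull f →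
        (∀ x : E, Tendsto (fun n => |adjointOp T (f n)| x) atTop (𝓝 0)) ∧
        (∀ x : ℕ → E, (∀ n, x n ∈ Metric.closedBall 0 1 ∧ 0 ≤ x n) → DisjointSeq x →
          Tendsto (fun n => f n (T (x n))) atTop (𝓝 0))] := by
  have hA : ∀ A : Set E, A.Nonempty → Bornology.IsBounded A →
      LatticeOrderedAddCommGroup.IsSolid A → List.TFAE [
        IsLWeaklyCompact (T '' A),
        (∀ x ∈ A, 0 ≤ x → IsLWeaklyCompact (T '' Set.Icc (-x) x)) ∧
          (∀ x : ℕ → E, (∀ n, x n ∈ A ∧ 0 ≤ x n) → DisjointSeq x →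
            IsLWeaklyCompact (Set.range fun n => T (x n))),
        ∀ f : ℕ → StrongDual ℝ F, Bornology.IsBounded (Set.range f) → UawNull f →
          (∀ x ∈ A, 0 ≤ x → Tendsto (fun n => |adjointOp T (f n)| x) atTop (𝓝 0)) ∧
          (∀ x : ℕ → E, (∀ n, x n ∈ A ∧ 0 ≤ x n) → DisjointSeq x →
            Tendsto (fun n => f n (T (x n))) atTop (𝓝 0))] := by
    intro A hne hb hA
    tfae_have 1 → 2 := by
      refine fun h => ⟨fun x hxA hx => h.mono ?_ (Set.image_mono fun y hy => ?_),
        fun x hx _ => h.mono (Set.range_nonempty _) ?_⟩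
      · exact (Set.nonempty_Icc.2 (neg_le_self hx)).image T
      · exact hA hxA ((mem_Icc_neg_iff_abs_le.1 hy).trans (le_abs_self x))
      · rintro _ ⟨n, rfl⟩
        exact ⟨x n, (hx n).1, rfl⟩
    tfae_have 2 → 3 := fun h f hfb hf =>
      ⟨fun x hxA hx => tendsto_abs_adjointOp_apply hx (h.1 x hxA hx) hfb hf,
        fun x hx hxd => tendsto_apply_of_abs_apply_abs
          ((h.2 x hx hxd).tendsto_abs_apply_abs hfb hf fun n => ⟨n, rfl⟩)⟩
    tfae_have 3 → 1 := isLWeaklyCompact_image_of_tendsto hne hb hA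
    tfae_finish
  refine ⟨hA, ?_⟩
  -- The norm is a lattice norm, so the unit ball is solid and (A) applies to it.
  have hball := hA (Metric.closedBall 0 1) ⟨0, by simp⟩ Metric.isBounded_closedBall
    fun x hx y hyx => mem_closedBall_zero_iff.2
      ((norm_le_norm_of_abs_le_abs hyx).trans (mem_closedBall_zero_iff.1 hx))
  tfae_have 2 → 1 := isUawDunfordPettis_adjointOp
  tfae_have 1 → 3 := by
    refine fun h => ⟨fun x hx => h.isLWeaklyCompact_image
      (Set.nonempty_Icc.2 (neg_le_self hx)) ?_, fun x hx _ => ?_⟩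
    · refine isBounded_iff_forall_norm_le.2 ⟨‖x‖, fun y hy => norm_le_norm_of_abs_le_abs ?_⟩
      exact (mem_Icc_neg_iff_abs_le.1 hy).trans (le_abs_self x)
    · rw [show (Set.range fun n => T (x n)) = T '' Set.range x from Set.range_comp T x]
      refine h.isLWeaklyCompact_image (Set.range_nonempty x)
        ((Metric.isBounded_closedBall (x := (0 : E)) (r := 1)).subset ?_)
      rintro _ ⟨n, rfl⟩
      exact (hx n).1
  have hball₂ := hball.out 1 0
  have hball₃ := hball.out 2 0
  -- The conditions of (B) range over all of `E⁺`, or all of `E`, and so contain those of (A) for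
  -- the ball.
  tfae_have 3 → 2 := fun h => hball₂.1 ⟨fun x _ hx => h.1 x hx, h.2⟩
  tfae_have 1 → 4 := by
    refine fun h f hfb hf => ⟨fun x => ?_, fun x hx _ => h.tendsto_apply hfb hf
      fun n => mem_closedBall_zero_iff.1 (hx n).1⟩
    have hlim := (h f hfb hf).mul_const ‖x‖
    rw [zero_mul] at hlim
    refine squeeze_zero_norm (fun n => ?_) hlim
    rw [← norm_abs_eq_norm (adjointOp T (f n))]
    exact |adjointOp T (f n)|.le_opNorm x
  tfae_have 4 → 2 := fun h => hball₃.1 fun f hfb hf =>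
    ⟨fun x _ _ => (h f hfb hf).1 x, (h f hfb hf).2⟩
  tfae_finish
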